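/- **Definitions.** Let $S$ be a set of signals. *Statements* of Kernel Esterel are $$p,q ::= k\ (k\in\mathbb N)\mid {!s}\mid \mathsf{aw}\,\ell\mid s?p{:}q\mid s\supset p\mid p;q\mid p\,|\,q\mid p^{*}\mid \{p\}\mid {\uparrow}p\mid p\backslash s ,$$ where $s\in S$ and $\ell$ is a literal $s$ or $\lnot s$ (in turn: nothing/pause/exit for $k=0$, $k=1$, $k\ge2$; emit; await immediate; presence test; delayed suspension; sequence; parallel; loop; trap; shift; local signal declaration). An *event* $E$ is a partial map $S\rightharpoonup\{+,-,\bot\}$ whose domain is the set of visible signals; $s^xE$ is $E$ with $s$ (re)bound to $x$; $s^x\in E$ means that $E(s)$ is defined and equals $x$; $\ell$ is true (false) in $E$ if $E$ gives its signal the status $+$ ($-$), conversely for a negated signal. An output event $E'$ is given by the finite set of emitted signals. On completion codes, ${\downarrow}k=0,1,0,k-1$ for $k=0$, $k=1$, $k=2$, $k>2$, and ${\uparrow}k=k$ for $k\le1$, ${\uparrow}k=k+1$ for $k\ge2$. Put $\delta_1(p)=p$ and $\delta_k(p)=0$ for $k\neq1$. *Must and Can* ($b\in\{+,-\}$). $\mathrm{Must}(p,E)=(M_s,M_k)$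 and $\mathrm{Can}^b(p,E)=(C^b_s,C^b_k)$ are pairs of a set of signals and a set of codes (unions, inclusions and case values are componentwise on pairs). Both equal $(\emptyset,\{k\})$ for $k$; $(\{s\},\{0\})$ for $!s$; for $\mathsf{aw}\,\ell$ they are $(\emptyset,\{0\})$ if $\ell$ is true, $(\emptyset,\{1\})$ if $\ell$ is false, and otherwise $\mathrm{Must}=(\emptyset,\emptyset)$, $\mathrm{Can}^b=(\emptyset,\{0,1\})$. For $s?p{:}q$ they are those of $p$ if $s^+\in E$, of $q$ if $s^-\in E$, and otherwise $\mathrm{Must}=(\emptyset,\emptyset)$, $\mathrm{Can}^b=\mathrm{Can}^-(p,E)\cup\mathrm{Can}^-(q,E)$. For $s\supset p$ and $p^*$ they are those of $p$. For $p|q$: union of the signal sets, and $\{\max(k,l)\}$ with $k,l$ ranging over the two code sets. For $\{p\}$, ${\uparrow}p$: apply $\downarrow$, $\uparrow$ to the codes. $\mathrm{Must}(p;q,E)$ is $\mathrm{Must}(p,E)$ if $0\notin M_k(p,E)$, else $(M_s(p,E)\cup M_s(q,E),M_k(q,E))$. $\mathrm{Can}^b(p;q,E)$ is $\mathrm{Can}^b(p,E)$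 if $0\notin C^b_k(p,E)$, else $(C^b_s(p,E)\cup C^{c}_s(q,E),(C^b_k(p,E)\setminus\{0\})\cup C^{c}_k(q,E))$ with $c=+$ if $0\in M_k(p,E)$ and $b=+$, and $c=-$ otherwise. $\mathrm{Must}(p\backslash s,E)$ is $\mathrm{Must}(p,s^xE)$ with $s$ removed from the signals, where $x=+$ if $s\in M_s(p,s^\bot E)$; else $x=-$ if $s\notin C^+_s(p,s^\bot E)$; else $x=\bot$. $\mathrm{Can}^b(p\backslash s,E)$ is obtained likewise from $\mathrm{Can}^b(p,s^xE)$, except that $x=+$ also requires $b=+$. *Constructive behavioral semantics (CBS).* Transitions $p\xrightarrow[E]{E',k}p'$ are inductively generated by: - $k\xrightarrow[E]{\emptyset,k}0$; ${!s}\xrightarrow[E]{\{s\},0}0$ if $s\in\mathrm{dom}\,E$; $\mathsf{aw}\,\ell\xrightarrow[E]{\emptyset,0}0$ if $\ell$ is true in $E$, $\mathsf{aw}\,\ell\xrightarrow[E]{\emptyset,1}\mathsf{aw}\,\ell$ if $\ell$ is false in $E$. - $s?p{:}q$ has the transitions of $p$ if $s^+\in E$ and those of $q$ if $s^-\in E$.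 - If $p\xrightarrow[E]{E',k}p'$, then $s\supset p\xrightarrow[E]{E',k}\delta_k(\mathsf{aw}\,\lnot s;(s\supset p'))$, $\{p\}\xrightarrow[E]{E',\downarrow k}\delta_k(\{p'\})$, ${\uparrow}p\xrightarrow[E]{E',\uparrow k}\delta_k({\uparrow}p')$; and if moreover $k\ne0$, then $p;q\xrightarrow[E]{E',k}\delta_k(p';q)$ and $p^*\xrightarrow[E]{E',k}\delta_k(p';p^*)$. - If $p\xrightarrow[E]{E_1,0}p'$ and $q\xrightarrow[E]{E_2,k}q'$, then $p;q\xrightarrow[E]{E_1\cup E_2,k}q'$. - If $p\xrightarrow[E]{E_1,k}p'$, $q\xrightarrow[E]{E_2,l}q'$, $m=\max(k,l)$, then $p|q\xrightarrow[E]{E_1\cup E_2,m}\delta_m(p'|q')$. - If $s\in M_s(p,s^\bot E)$ and $p\xrightarrow[s^+E]{E',k}p'$, or if $s\notin C^+_s(p,s^\bot E)$ and $p\xrightarrow[s^-E]{E',k}p'$, then $p\backslash s\xrightarrow[E]{E'\setminus\{s\},k}\delta_k(p'\backslash s)$. $\approx$ is bisimilarity for these transitions: the largest relation such that if $p\approx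 q$, every transition $p\xrightarrow[E]{E',k}p'$ is matched by some $q\xrightarrow[E]{E',k}q'$ with $p'\approx q'$, and vice versa. *States and terms.* States are $$\hat p,\hat q::=\hat1\mid\widehat{\mathsf{aw}\,\ell}\mid s\supset\hat p\mid s?\hat p{:}q\mid s?p{:}\hat q\mid\hat p;q\mid p;\hat q\mid\hat p|q\mid p|\hat q\mid\hat p|\hat q\mid\hat p^*\mid\{\hat p\}\mid{\uparrow}\hat p\mid\hat p\backslash s .$$ The base $\mathcal B(\hat p)$ is the statement obtained by removing the hats. A *term* $\bar p$ is a state or a statement; base extends to terms by $\mathcal B(p)=p$, the constructors are lifted to terms in the obvious way (e.g. $s?\bar p{:}q$ is a state or a statement according to $\bar p$), and $\delta_1(\bar p)=\bar p$, $\delta_k(\bar p)=\mathcal B(\bar p)$ for $k\ne1$. The *expansion* $\mathcal E$ of a state is: $\mathcal E(\hat1)=0$; $\mathcal E(\widehat{\mathsf{aw}\,\ell})=\mathsf{aw}\,\ell$; $\mathcal E(s\supset\hat p)=\mathsf{aw}\,\lnot s;(s\supset\mathcal E(\hat p))$; $\mathcal E(s?\hat p{:}q)=\mathcal E(\hat p)$;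 $\mathcal E(s?p{:}\hat q)=\mathcal E(p;\hat q)=\mathcal E(\hat q)$; $\mathcal E(\hat p;q)=\mathcal E(\hat p);q$; $\mathcal E(\hat p|q)=\mathcal E(\hat p)|0$; $\mathcal E(p|\hat q)=0|\mathcal E(\hat q)$; $\mathcal E(\hat p|\hat q)=\mathcal E(\hat p)|\mathcal E(\hat q)$; $\mathcal E(\hat p^*)=\mathcal E(\hat p);\mathcal B(\hat p)^*$; $\mathcal E(\{\hat p\})=\{\mathcal E(\hat p)\}$; $\mathcal E({\uparrow}\hat p)={\uparrow}\mathcal E(\hat p)$; $\mathcal E(\hat p\backslash s)=\mathcal E(\hat p)\backslash s$. A statement is its own expansion. *Constructive state semantics (CSS), start transitions* $p\overset{\mathsf s}{\underset{E}{\longrightarrow}}(E',k,\bar p')$ are inductively generated by: - $0\to(\emptyset,0,0)$; $1\to(\emptyset,1,\hat1)$; $k\to(\emptyset,k,k)$ for $k\ge2$; ${!s}\to(\{s\},0,{!s})$ if $s\in\mathrm{dom}\,E$; $\mathsf{aw}\,\ell\to(\emptyset,0,\mathsf{aw}\,\ell)$ if $\ell$ is true in $E$; $\mathsf{aw}\,\ell\to(\emptyset,1,\widehat{\mathsf{aw}\,\ell})$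 if $\ell$ is false in $E$. - If $p\to(E',k,\bar p')$, then $s\supset p\to(E',k,s\supset\bar p')$, $\{p\}\to(E',{\downarrow}k,\{\bar p'\})$, ${\uparrow}p\to(E',{\uparrow}k,{\uparrow}\bar p')$, $s?p{:}q\to(E',k,s?\bar p'{:}q)$ if $s^+\in E$, $s?q{:}p\to(E',k,s?q{:}\bar p')$ if $s^-\in E$, and, if $k\neq0$, $p;q\to(E',k,\bar p';q)$ and $p^*\to(E',k,\bar p'^*)$. - If $p\to(E_1,0,p)$ and $q\to(E_2,k,\bar q')$, then $p;q\to(E_1\cup E_2,k,p;\bar q')$. - If $p\to(E_1,k,\bar p')$, $q\to(E_2,l,\bar q')$, $m=\max(k,l)$, then $p|q\to(E_1\cup E_2,m,\delta_m(\bar p'|\bar q'))$. - If $s\in M_s(p,s^\bot E)$ and $p\to(E',k,\bar p')$ under $s^+E$, or $s\notin C_s^+(p,s^\bot E)$ and $p\to(E',k,\bar p')$ under $s^-E$, then $p\backslash s\to(E'\setminus\{s\},k,\bar p'\backslash s)$ under $E$. *Resume transitions* $\hat p\overset{\mathsf r}{\underset{E}{\longrightarrow}}(E',k,\bar p')$ are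 inductively generated by: - $\hat1\to(\emptyset,0,1)$; $\widehat{\mathsf{aw}\,\ell}\to(\emptyset,0,\mathsf{aw}\,\ell)$ if $\ell$ is true in $E$, $\widehat{\mathsf{aw}\,\ell}\to(\emptyset,1,\widehat{\mathsf{aw}\,\ell})$ if $\ell$ is false in $E$; $s\supset\hat p\to(\emptyset,1,s\supset\hat p)$ if $s^+\in E$. - If $\hat p\to(E',k,\bar p')$, then $s\supset\hat p\to(E',k,s\supset\bar p')$ if $s^-\in E$; $s?\hat p{:}q\to(E',k,s?\bar p'{:}q)$; $s?q{:}\hat p\to(E',k,s?q{:}\bar p')$; $q;\hat p\to(E',k,q;\bar p')$; $\{\hat p\}\to(E',{\downarrow}k,\{\bar p'\})$; ${\uparrow}\hat p\to(E',{\uparrow}k,{\uparrow}\bar p')$; $\hat p|q\to(E',k,\bar p'|q)$; $q|\hat p\to(E',k,q|\bar p')$; and, if $k\ne0$, $\hat p;q\to(E',k,\bar p';q)$ and $\hat p^*\to(E',k,\bar p'^*)$. - If $\hat p\to(E_1,0,p)$ with $p=\mathcal B(\hat p)$ and $q\to(E_2,k,\bar q')$ is a start transition, then $\hat p;q\to(E_1\cup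 E_2,k,p;\bar q')$; if $\hat p\to(E_1,0,p)$ with $p=\mathcal B(\hat p)$, $k\ne0$ and $p\to(E_2,k,\bar p')$ is a start transition, then $\hat p^*\to(E_1\cup E_2,k,\bar p'^*)$. - If $\hat p\to(E_1,k,\bar p')$, $\hat q\to(E_2,l,\bar q')$, $m=\max(k,l)$, then $\hat p|\hat q\to(E_1\cup E_2,m,\delta_m(\bar p'|\bar q'))$. - If $s\in M_s(\mathcal E(\hat p),s^\bot E)$ and $\hat p\to(E',k,\bar p')$ under $s^+E$, or $s\notin C_s^+(\mathcal E(\hat p),s^\bot E)$ and $\hat p\to(E',k,\bar p')$ under $s^-E$, then $\hat p\backslash s\to(E'\setminus\{s\},k,\bar p'\backslash s)$ under $E$. **Theorem (Equivalence between the constructive and state semantics).** For all statements $p$, states $\hat p$, events $E$, output events $E'$ and codes $k$: 1. for every statement $p'$, if $p\xrightarrow[E]{E',k}p'$, then there is a term $\bar p''$ with $p\overset{\mathsf s}{\underset{E}{\longrightarrow}}(E',k,\bar p'')$ and $p'\approx\delta_k(\mathcal E(\bar p''))$; 2. for every statement $p'$, if $\mathcal E(\hat p)\xrightarrow[E]{E',k}p'$,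 then there is a term $\bar p''$ with $\hat p\overset{\mathsf r}{\underset{E}{\longrightarrow}}(E',k,\bar p'')$ and $p'\approx\delta_k(\mathcal E(\bar p''))$; 3. for every term $\bar p'$, if $p\overset{\mathsf s}{\underset{E}{\longrightarrow}}(E',k,\bar p')$, then there is a statement $p''$ with $p\xrightarrow[E]{E',k}p''$ and $p''\approx\delta_k(\mathcal E(\bar p'))$; 4. for every term $\bar p'$, if $\hat p\overset{\mathsf r}{\underset{E}{\longrightarrow}}(E',k,\bar p')$, then there is a statement $p''$ with $\mathcal E(\hat p)\xrightarrow[E]{E',k}p''$ and $p''\approx\delta_k(\mathcal E(\bar p'))$. -/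

import Mathlib

namespace Esterel

/-- Kernel Esterel statements over a type `S` of signals. `code k` is the statement `k`:
`nothing` for `k = 0`, `pause` for `k = 1`, and the trap exit `k` for `k ≥ 2`.
`awimm true s` is `await immediate s` and `awimm false s` is `await immediate ¬s`
(the latter is needed for the derivatives of `suspend`). -/
inductive Prog (S : Type*) where
  | code (k : ℕ)
  | emit (s : S)
  | awimm (b : Bool) (s : S)
  | ite (s : S) (p q : Prog S)
  | suspend (s : S) (p : Prog S)
  | seq (p q : Prog S)
  | par (p q : Prog S)
  | loop (p : Prog S)
  | trap (p : Prog S)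
  | shift (p : Prog S)
  | signal (s : S) (p : Prog S)

/-- The statuses of the constructive semantics: present, absent, unknown. -/
inductive Status where
  | plus
  | minus
  | bot

/-- The definite status named by a polarity. -/
def Status.ofBool : Bool → Status
  | true => .plus
  | false => .minus

/-- A (constructive) event: a map to statuses from a set of signals, the visible ones;
`E s = none` means that `s` is not visible. -/
abbrev Event (S : Type*) := S → Option Status

/-- The event `E` in which `s` is (re)bound to the status `x`. -/
def Event.bind {S : Type*} [DecidableEq S] (E : Event S) (s : S) (x : Status) : Event S :=
  Function.update E s (some x)

/-- `↓k`: the completion code of `trap p` when `p` completes with `k`. -/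
def down : ℕ → ℕ
  | 0 => 0
  | 1 => 1
  | 2 => 0
  | k + 3 => k + 2

/-- `↑k`: the completion code of `shift p` when `p` completes with `k`. -/
def up : ℕ → ℕ
  | 0 => 0
  | 1 => 1
  | k + 2 => k + 3

/-- `δ_k`: kill the derivative unless the completion code is `1`. -/
def delta {S : Type*} (k : ℕ) (p : Prog S) : Prog S :=
  if k = 1 then p else .code 0

/-- The values of `Must` and `Can`: a set of signals and a set of completion codes. -/
structure Result (S : Type*) where
  sig : Finset S
  cod : Finset ℕ

mutual

/-- The function `Must`. -/
def must {S : Type*} [DecidableEq S] : Prog S → Event S → Result S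
  | .code k, _ => ⟨∅, {k}⟩
  | .emit s, _ => ⟨{s}, {0}⟩
  | .awimm b s, E =>
    match E s with
    | some .plus => ⟨∅, if b then {0} else {1}⟩
    | some .minus => ⟨∅, if b then {1} else {0}⟩
    | _ => ⟨∅, ∅⟩
  | .ite s p q, E =>
    match E s with
    | some .plus => must p E
    | some .minus => must q E
    | _ => ⟨∅, ∅⟩
  | .suspend _ p, E => must p E
  | .loop p, E => must p E
  | .par p q, E =>
    ⟨(must p E).sig ∪ (must q E).sig, Finset.image₂ max (must p E).cod (must q E).cod⟩
  | .trap p, E => ⟨(must p E).sig, (must p E).cod.image down⟩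
  | .shift p, E => ⟨(must p E).sig, (must p E).cod.image up⟩
  | .seq p q, E =>
    if 0 ∈ (must p E).cod then ⟨(must p E).sig ∪ (must q E).sig, (must q E).cod⟩
    else must p E
  | .signal s p, E =>
    if s ∈ (must p (E.bind s .bot)).sig then
      ⟨(must p (E.bind s .plus)).sig.erase s, (must p (E.bind s .plus)).cod⟩
    else if s ∉ (can p true (E.bind s .bot)).sig then
      ⟨(must p (E.bind s .minus)).sig.erase s, (must p (E.bind s .minus)).cod⟩
    else
      ⟨(must p (E.bind s .bot)).sig.erase s, (must p (E.bind s .bot)).cod⟩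

/-- The function `Can^b`, with `b = true` for `Can⁺` and `b = false` for `Can⁻`. -/
def can {S : Type*} [DecidableEq S] : Prog S → Bool → Event S → Result S
  | .code k, _, _ => ⟨∅, {k}⟩
  | .emit s, _, _ => ⟨{s}, {0}⟩
  | .awimm c s, _, E =>
    match E s with
    | some .plus => ⟨∅, if c then {0} else {1}⟩
    | some .minus => ⟨∅, if c then {1} else {0}⟩
    | _ => ⟨∅, {0, 1}⟩
  | .ite s p q, b, E =>
    match E s with
    | some .plus => can p b E
    | some .minus => can q b E
    | _ => ⟨(can p false E).sig ∪ (can q false E).sig, (can p false E).cod ∪ (can q false E).cod⟩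
  | .suspend _ p, b, E => can p b E
  | .loop p, b, E => can p b E
  | .par p q, b, E =>
    ⟨(can p b E).sig ∪ (can q b E).sig, Finset.image₂ max (can p b E).cod (can q b E).cod⟩
  | .trap p, b, E => ⟨(can p b E).sig, (can p b E).cod.image down⟩
  | .shift p, b, E => ⟨(can p b E).sig, (can p b E).cod.image up⟩
  | .seq p q, b, E =>
    if 0 ∉ (can p b E).cod then can p b E
    else if 0 ∈ (must p E).cod ∧ b = true then
      ⟨(can p b E).sig ∪ (can q true E).sig, (can p b E).cod.erase 0 ∪ (can q true E).cod⟩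
    else
      ⟨(can p b E).sig ∪ (can q false E).sig, (can p b E).cod.erase 0 ∪ (can q false E).cod⟩
  | .signal s p, b, E =>
    if s ∈ (must p (E.bind s .bot)).sig ∧ b = true then
      ⟨(can p b (E.bind s .plus)).sig.erase s, (can p b (E.bind s .plus)).cod⟩
    else if s ∉ (can p true (E.bind s .bot)).sig then
      ⟨(can p b (E.bind s .minus)).sig.erase s, (can p b (E.bind s .minus)).cod⟩
    else
      ⟨(can p b (E.bind s .bot)).sig.erase s, (can p b (E.bind s .bot)).cod⟩

end

/-- The constructive behavioral semantics: `CBS p E E' k p'` is the transition of `p`, reading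
the event `E`, with emitted signals `E'`, completion code `k` and derivative `p'`. The output
event maps the emitted signals to `+`, so it is given as the set of these signals. -/
inductive CBS {S : Type*} [DecidableEq S] : Prog S → Event S → Finset S → ℕ → Prog S → Prop
  | code {E : Event S} {k : ℕ} : CBS (.code k) E ∅ k (.code 0)
  | emit {E : Event S} {s : S} (hs : (E s).isSome) : CBS (.emit s) E {s} 0 (.code 0)
  | suspend {E : Event S} {s : S} {p p' : Prog S} {E' : Finset S} {k : ℕ}
      (hp : CBS p E E' k p') :
      CBS (.suspend s p) E E' k (delta k (.seq (.awimm false s) (.suspend s p')))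
  | awimm_now {E : Event S} {b : Bool} {s : S} (hs : E s = some (.ofBool b)) :
      CBS (.awimm b s) E ∅ 0 (.code 0)
  | awimm_wait {E : Event S} {b : Bool} {s : S} (hs : E s = some (.ofBool !b)) :
      CBS (.awimm b s) E ∅ 1 (.awimm b s)
  | ite_then {E : Event S} {s : S} {p q p' : Prog S} {E' : Finset S} {k : ℕ}
      (hs : E s = some .plus) (hp : CBS p E E' k p') : CBS (.ite s p q) E E' k p'
  | ite_else {E : Event S} {s : S} {p q q' : Prog S} {E' : Finset S} {k : ℕ}
      (hs : E s = some .minus) (hq : CBS q E E' k q') : CBS (.ite s p q) E E' k q'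
  | seq_k {E : Event S} {p q p' : Prog S} {E' : Finset S} {k : ℕ}
      (hk : k ≠ 0) (hp : CBS p E E' k p') : CBS (.seq p q) E E' k (delta k (.seq p' q))
  | seq_zero {E : Event S} {p q p' q' : Prog S} {E₁ E₂ : Finset S} {k : ℕ}
      (hp : CBS p E E₁ 0 p') (hq : CBS q E E₂ k q') : CBS (.seq p q) E (E₁ ∪ E₂) k q'
  | shift {E : Event S} {p p' : Prog S} {E' : Finset S} {k : ℕ}
      (hp : CBS p E E' k p') : CBS (.shift p) E E' (up k) (delta k (.shift p'))
  | loop {E : Event S} {p p' : Prog S} {E' : Finset S} {k : ℕ}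
      (hk : k ≠ 0) (hp : CBS p E E' k p') : CBS (.loop p) E E' k (delta k (.seq p' (.loop p)))
  | trap {E : Event S} {p p' : Prog S} {E' : Finset S} {k : ℕ}
      (hp : CBS p E E' k p') : CBS (.trap p) E E' (down k) (delta k (.trap p'))
  | par {E : Event S} {p q p' q' : Prog S} {E₁ E₂ : Finset S} {kp kq : ℕ}
      (hp : CBS p E E₁ kp p') (hq : CBS q E E₂ kq q') :
      CBS (.par p q) E (E₁ ∪ E₂) (max kp kq) (delta (max kp kq) (.par p' q'))
  | signal_plus {E : Event S} {s : S} {p p' : Prog S} {E' : Finset S} {k : ℕ}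
      (hs : s ∈ (must p (E.bind s .bot)).sig) (hp : CBS p (E.bind s .plus) E' k p') :
      CBS (.signal s p) E (E'.erase s) k (delta k (.signal s p'))
  | signal_minus {E : Event S} {s : S} {p p' : Prog S} {E' : Finset S} {k : ℕ}
      (hs : s ∉ (can p true (E.bind s .bot)).sig) (hp : CBS p (E.bind s .minus) E' k p') :
      CBS (.signal s p) E (E'.erase s) k (delta k (.signal s p'))

/-- A relation on statements is a bisimulation (for the CBS transitions) when each side can
match every transition of the other one with the same input event, output event and
completion code, the derivatives being related again. -/
def IsBisimulation {S : Type*} [DecidableEq S] (R : Prog S → Prog S → Prop) : Prop :=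
  ∀ p q : Prog S, R p q → ∀ (E : Event S) (E' : Finset S) (k : ℕ),
    (∀ p', CBS p E E' k p' → ∃ q', CBS q E E' k q' ∧ R p' q') ∧
    (∀ q', CBS q E E' k q' → ∃ p', CBS p E E' k p' ∧ R p' q')

/-- Bisimilarity of statements. -/
def Bisimilar {S : Type*} [DecidableEq S] (p q : Prog S) : Prop :=
  ∃ R : Prog S → Prog S → Prop, IsBisimulation R ∧ R p q

/-- States: statements in which the `pause` and `await immediate` statements where execution
has to be resumed are marked as activated. -/
inductive State (S : Type*) where
  | pause
  | awimm (b : Bool) (s : S)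
  | suspend (s : S) (p : State S)
  | iteL (s : S) (p : State S) (q : Prog S)
  | iteR (s : S) (p : Prog S) (q : State S)
  | seqL (p : State S) (q : Prog S)
  | seqR (p : Prog S) (q : State S)
  | parL (p : State S) (q : Prog S)
  | parR (p : Prog S) (q : State S)
  | parB (p q : State S)
  | loop (p : State S)
  | trap (p : State S)
  | shift (p : State S)
  | signal (s : S) (p : State S)

/-- The underlying statement of a state. -/
def State.base {S : Type*} : State S → Prog S
  | .pause => .code 1
  | .awimm b s => .awimm b s
  | .suspend s p => .suspend s p.base
  | .iteL s p q => .ite s p.base q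
  | .iteR s p q => .ite s p q.base
  | .seqL p q => .seq p.base q
  | .seqR p q => .seq p q.base
  | .parL p q => .par p.base q
  | .parR p q => .par p q.base
  | .parB p q => .par p.base q.base
  | .loop p => .loop p.base
  | .trap p => .trap p.base
  | .shift p => .shift p.base
  | .signal s p => .signal s p.base

/-- The expansion of a state: the statement that is left to execute. -/
def State.expand {S : Type*} : State S → Prog S
  | .pause => .code 0
  | .awimm b s => .awimm b s
  | .suspend s p => .seq (.awimm false s) (.suspend s p.expand)
  | .iteL _ p _ => p.expand
  | .iteR _ _ q => q.expand
  | .seqL p q => .seq p.expand q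
  | .seqR _ q => q.expand
  | .parL p _ => .par p.expand (.code 0)
  | .parR _ q => .par (.code 0) q.expand
  | .parB p q => .par p.expand q.expand
  | .loop p => .seq p.expand (.loop p.base)
  | .trap p => .trap p.expand
  | .shift p => .shift p.expand
  | .signal s p => .signal s p.expand

/-- A term is a state or a statement. -/
inductive Term (S : Type*) where
  | state (p : State S)
  | prog (p : Prog S)

namespace Term

variable {S : Type*}

/-- The underlying statement of a term. -/
def base : Term S → Prog S
  | .state p => p.base
  | .prog p => p

/-- The expansion of a term; a statement is its own expansion. -/
def expand : Term S → Prog S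
  | .state p => p.expand
  | .prog p => p

/-- `δ_k` on terms. -/
def delta (k : ℕ) (t : Term S) : Term S :=
  if k = 1 then t else .prog t.base

/-! The constructors, lifted to terms. -/

def suspend (s : S) : Term S → Term S
  | .state p => .state (.suspend s p)
  | .prog p => .prog (.suspend s p)

def iteL (s : S) : Term S → Prog S → Term S
  | .state p, q => .state (.iteL s p q)
  | .prog p, q => .prog (.ite s p q)

def iteR (s : S) (p : Prog S) : Term S → Term S
  | .state q => .state (.iteR s p q)
  | .prog q => .prog (.ite s p q)

def seqL : Term S → Prog S → Term S
  | .state p, q => .state (.seqL p q)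
  | .prog p, q => .prog (.seq p q)

def seqR (p : Prog S) : Term S → Term S
  | .state q => .state (.seqR p q)
  | .prog q => .prog (.seq p q)

def par : Term S → Term S → Term S
  | .state p, .state q => .state (.parB p q)
  | .state p, .prog q => .state (.parL p q)
  | .prog p, .state q => .state (.parR p q)
  | .prog p, .prog q => .prog (.par p q)

def loop : Term S → Term S
  | .state p => .state (.loop p)
  | .prog p => .prog (.loop p)

def trap : Term S → Term S
  | .state p => .state (.trap p)
  | .prog p => .prog (.trap p)

def shift : Term S → Term S
  | .state p => .state (.shift p)
  | .prog p => .prog (.shift p)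

def signal (s : S) : Term S → Term S
  | .state p => .state (.signal s p)
  | .prog p => .prog (.signal s p)

end Term

/-- The start transitions of the constructive state semantics. -/
inductive CSSStart {S : Type*} [DecidableEq S] :
    Prog S → Event S → Finset S → ℕ → Term S → Prop
  | nothing {E : Event S} : CSSStart (.code 0) E ∅ 0 (.prog (.code 0))
  | pause {E : Event S} : CSSStart (.code 1) E ∅ 1 (.state .pause)
  | exit {E : Event S} {k : ℕ} (hk : 2 ≤ k) : CSSStart (.code k) E ∅ k (.prog (.code k))
  | emit {E : Event S} {s : S} (hs : (E s).isSome) :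
      CSSStart (.emit s) E {s} 0 (.prog (.emit s))
  | suspend {E : Event S} {s : S} {p : Prog S} {t : Term S} {E' : Finset S} {k : ℕ}
      (hp : CSSStart p E E' k t) : CSSStart (.suspend s p) E E' k (t.suspend s)
  | awimm_now {E : Event S} {b : Bool} {s : S} (hs : E s = some (.ofBool b)) :
      CSSStart (.awimm b s) E ∅ 0 (.prog (.awimm b s))
  | awimm_wait {E : Event S} {b : Bool} {s : S} (hs : E s = some (.ofBool !b)) :
      CSSStart (.awimm b s) E ∅ 1 (.state (.awimm b s))
  | ite_then {E : Event S} {s : S} {p q : Prog S} {t : Term S} {E' : Finset S} {k : ℕ}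
      (hs : E s = some .plus) (hp : CSSStart p E E' k t) :
      CSSStart (.ite s p q) E E' k (t.iteL s q)
  | ite_else {E : Event S} {s : S} {p q : Prog S} {t : Term S} {E' : Finset S} {k : ℕ}
      (hs : E s = some .minus) (hq : CSSStart q E E' k t) :
      CSSStart (.ite s p q) E E' k (t.iteR s p)
  | seq_k {E : Event S} {p q : Prog S} {t : Term S} {E' : Finset S} {k : ℕ}
      (hk : k ≠ 0) (hp : CSSStart p E E' k t) : CSSStart (.seq p q) E E' k (t.seqL q)
  | seq_zero {E : Event S} {p q : Prog S} {t : Term S} {E₁ E₂ : Finset S} {k : ℕ}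
      (hp : CSSStart p E E₁ 0 (.prog p)) (hq : CSSStart q E E₂ k t) :
      CSSStart (.seq p q) E (E₁ ∪ E₂) k (t.seqR p)
  | shift {E : Event S} {p : Prog S} {t : Term S} {E' : Finset S} {k : ℕ}
      (hp : CSSStart p E E' k t) : CSSStart (.shift p) E E' (up k) t.shift
  | loop {E : Event S} {p : Prog S} {t : Term S} {E' : Finset S} {k : ℕ}
      (hk : k ≠ 0) (hp : CSSStart p E E' k t) : CSSStart (.loop p) E E' k t.loop
  | trap {E : Event S} {p : Prog S} {t : Term S} {E' : Finset S} {k : ℕ}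
      (hp : CSSStart p E E' k t) : CSSStart (.trap p) E E' (down k) t.trap
  | par {E : Event S} {p q : Prog S} {t u : Term S} {E₁ E₂ : Finset S} {kp kq : ℕ}
      (hp : CSSStart p E E₁ kp t) (hq : CSSStart q E E₂ kq u) :
      CSSStart (.par p q) E (E₁ ∪ E₂) (max kp kq) ((t.par u).delta (max kp kq))
  | signal_plus {E : Event S} {s : S} {p : Prog S} {t : Term S} {E' : Finset S} {k : ℕ}
      (hs : s ∈ (must p (E.bind s .bot)).sig) (hp : CSSStart p (E.bind s .plus) E' k t) :
      CSSStart (.signal s p) E (E'.erase s) k (t.signal s)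
  | signal_minus {E : Event S} {s : S} {p : Prog S} {t : Term S} {E' : Finset S} {k : ℕ}
      (hs : s ∉ (can p true (E.bind s .bot)).sig) (hp : CSSStart p (E.bind s .minus) E' k t) :
      CSSStart (.signal s p) E (E'.erase s) k (t.signal s)

/-- The resume transitions of the constructive state semantics. -/
inductive CSSResume {S : Type*} [DecidableEq S] :
    State S → Event S → Finset S → ℕ → Term S → Prop
  | pause {E : Event S} : CSSResume .pause E ∅ 0 (.prog (.code 1))
  | awimm_now {E : Event S} {b : Bool} {s : S} (hs : E s = some (.ofBool b)) :
      CSSResume (.awimm b s) E ∅ 0 (.prog (.awimm b s))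
  | awimm_wait {E : Event S} {b : Bool} {s : S} (hs : E s = some (.ofBool !b)) :
      CSSResume (.awimm b s) E ∅ 1 (.state (.awimm b s))
  | suspend_plus {E : Event S} {s : S} {p : State S} (hs : E s = some .plus) :
      CSSResume (.suspend s p) E ∅ 1 (.state (.suspend s p))
  | suspend_minus {E : Event S} {s : S} {p : State S} {t : Term S} {E' : Finset S} {k : ℕ}
      (hs : E s = some .minus) (hp : CSSResume p E E' k t) :
      CSSResume (.suspend s p) E E' k (t.suspend s)
  | ite_then {E : Event S} {s : S} {p : State S} {q : Prog S} {t : Term S} {E' : Finset S}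
      {k : ℕ} (hp : CSSResume p E E' k t) : CSSResume (.iteL s p q) E E' k (t.iteL s q)
  | ite_else {E : Event S} {s : S} {p : Prog S} {q : State S} {t : Term S} {E' : Finset S}
      {k : ℕ} (hq : CSSResume q E E' k t) : CSSResume (.iteR s p q) E E' k (t.iteR s p)
  | seq_k {E : Event S} {p : State S} {q : Prog S} {t : Term S} {E' : Finset S} {k : ℕ}
      (hk : k ≠ 0) (hp : CSSResume p E E' k t) : CSSResume (.seqL p q) E E' k (t.seqL q)
  | seq_zero {E : Event S} {p : State S} {q : Prog S} {t : Term S} {E₁ E₂ : Finset S} {k : ℕ}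
      (hp : CSSResume p E E₁ 0 (.prog p.base)) (hq : CSSStart q E E₂ k t) :
      CSSResume (.seqL p q) E (E₁ ∪ E₂) k (t.seqR p.base)
  | seq_right {E : Event S} {p : Prog S} {q : State S} {t : Term S} {E' : Finset S} {k : ℕ}
      (hq : CSSResume q E E' k t) : CSSResume (.seqR p q) E E' k (t.seqR p)
  | loop_k {E : Event S} {p : State S} {t : Term S} {E' : Finset S} {k : ℕ}
      (hk : k ≠ 0) (hp : CSSResume p E E' k t) : CSSResume (.loop p) E E' k t.loop
  | loop_zero {E : Event S} {p : State S} {t : Term S} {E₁ E₂ : Finset S} {k : ℕ}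
      (hk : k ≠ 0) (hp : CSSResume p E E₁ 0 (.prog p.base)) (hq : CSSStart p.base E E₂ k t) :
      CSSResume (.loop p) E (E₁ ∪ E₂) k t.loop
  | shift {E : Event S} {p : State S} {t : Term S} {E' : Finset S} {k : ℕ}
      (hp : CSSResume p E E' k t) : CSSResume (.shift p) E E' (up k) t.shift
  | trap {E : Event S} {p : State S} {t : Term S} {E' : Finset S} {k : ℕ}
      (hp : CSSResume p E E' k t) : CSSResume (.trap p) E E' (down k) t.trap
  | par_both {E : Event S} {p q : State S} {t u : Term S} {E₁ E₂ : Finset S} {kp kq : ℕ}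
      (hp : CSSResume p E E₁ kp t) (hq : CSSResume q E E₂ kq u) :
      CSSResume (.parB p q) E (E₁ ∪ E₂) (max kp kq) ((t.par u).delta (max kp kq))
  | par_left {E : Event S} {p : State S} {q : Prog S} {t : Term S} {E' : Finset S} {k : ℕ}
      (hp : CSSResume p E E' k t) : CSSResume (.parL p q) E E' k (t.par (.prog q))
  | par_right {E : Event S} {p : Prog S} {q : State S} {t : Term S} {E' : Finset S} {k : ℕ}
      (hq : CSSResume q E E' k t) : CSSResume (.parR p q) E E' k ((Term.prog p).par t)
  | signal_plus {E : Event S} {s : S} {p : State S} {t : Term S} {E' : Finset S} {k : ℕ}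
      (hs : s ∈ (must p.expand (E.bind s .bot)).sig)
      (hp : CSSResume p (E.bind s .plus) E' k t) :
      CSSResume (.signal s p) E (E'.erase s) k (t.signal s)
  | signal_minus {E : Event S} {s : S} {p : State S} {t : Term S} {E' : Finset S} {k : ℕ}
      (hs : s ∉ (can p.expand true (E.bind s .bot)).sig)
      (hp : CSSResume p (E.bind s .minus) E' k t) :
      CSSResume (.signal s p) E (E'.erase s) k (t.signal s)

end Esterel

namespace Esterel

variable {S : Type*}

-- The two semantics agree up to equality: the derivative of a behavioral transition is exactly
-- `delta k t.expand`, where `t` is the target of the matching state transition, so bisimilarity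
-- enters only through reflexivity.
--
-- The key invariant is the shape of targets (`IsTarget`): a transition with code 1 ends in a state
-- over the base of its source, and any other transition ends in that base itself. It follows from
-- the state rules alone (`CSSStart.isTarget`, `CSSResume.isTarget`). Under it, `residual` commutes
-- with each lifted constructor: for code 1 the expansion of the constructor is the derivative
-- written in the behavioral rule, and for the other codes both sides collapse to `code 0`.
--
-- Each state rule then mirrors a behavioral rule or a short composite of such rules, applied to the
-- expansion, and conversely. `must` and `can` are never analysed: both semantics evaluate them on
-- the same statement, so the side conditions for local signals transfer verbatim.

lemma down_eq_one {k : ℕ} : down k = 1 ↔ k = 1 := by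
  rcases k with _ | _ | _ | k <;> simp [down]

lemma up_eq_one {k : ℕ} : up k = 1 ↔ k = 1 := by
  rcases k with _ | _ | k <;> simp [up]

-- Shape of the targets of state transitions.

/-- The shape of the target of a transition with completion code `k` of a term with base `p`:
a state over `p` if `k = 1`, and the inert statement `p` otherwise. -/
def IsTarget (p : Prog S) (k : ℕ) (t : Term S) : Prop :=
  (k = 1 ∧ ∃ q : State S, t = .state q ∧ q.base = p) ∨ (k ≠ 1 ∧ t = .prog p)

/-- The `delta` in the parallel rule is what preserves the shape: if one branch pauses while the
other exits a trap, the lifted term is still a state and must be reset to its base. -/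
lemma IsTarget.par {p q : Prog S} {k l : ℕ} {t u : Term S} (ht : IsTarget p k t)
    (hu : IsTarget q l u) : IsTarget (.par p q) (max k l) ((t.par u).delta (max k l)) := by
  by_cases hm : max k l = 1
  · refine .inl ⟨hm, ?_⟩
    rcases ht with ⟨rfl, p', rfl, rfl⟩ | ⟨hk, rfl⟩ <;>
      rcases hu with ⟨rfl, q', rfl, rfl⟩ | ⟨hl, rfl⟩ <;>
      first
        | omega
        | simp [hm, Term.delta, Term.par, State.base]
  · refine .inr ⟨hm, ?_⟩
    rcases ht with ⟨rfl, p', rfl, rfl⟩ | ⟨hk, rfl⟩ <;>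
      rcases hu with ⟨rfl, q', rfl, rfl⟩ | ⟨hl, rfl⟩ <;>
      first
        | omega
        | simp [hm, Term.delta, Term.par, State.base, Term.base]

-- Residuals commute with the lifted constructors.

/-- The derivative left after reaching the term `t` with completion code `k`. -/
def residual (k : ℕ) (t : Term S) : Prog S := delta k t.expand

lemma residual_eq_zero {k : ℕ} (hk : k ≠ 1) (t : Term S) : residual k t = .code 0 := by
  simp [residual, delta, hk]

lemma IsTarget.residual_suspend {p : Prog S} {k : ℕ} {t : Term S} (h : IsTarget p k t) (s : S) :
    residual k (t.suspend s) = delta k (.seq (.awimm false s) (.suspend s (residual k t))) := by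
  rcases h with ⟨rfl, q, rfl, -⟩ | ⟨hk, rfl⟩
  · rfl
  · simp [residual, delta, hk]

/-- The test was decided at the start, so expansion forgets it. The shape matters here: for code 1
and a statement as target, the test would survive on the left only. -/
lemma IsTarget.residual_iteL {p : Prog S} {k : ℕ} {t : Term S} (h : IsTarget p k t) (s : S)
    (q : Prog S) : residual k (t.iteL s q) = residual k t := by
  rcases h with ⟨rfl, q, rfl, -⟩ | ⟨hk, rfl⟩
  · rfl
  · simp [residual, delta, hk]

lemma IsTarget.residual_iteR {p : Prog S} {k : ℕ} {t : Term S} (h : IsTarget p k t) (s : S)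
    (q : Prog S) : residual k (t.iteR s q) = residual k t := by
  rcases h with ⟨rfl, q, rfl, -⟩ | ⟨hk, rfl⟩
  · rfl
  · simp [residual, delta, hk]

lemma IsTarget.residual_seqL {p : Prog S} {k : ℕ} {t : Term S} (h : IsTarget p k t)
    (q : Prog S) : residual k (t.seqL q) = delta k (.seq (residual k t) q) := by
  rcases h with ⟨rfl, q, rfl, -⟩ | ⟨hk, rfl⟩
  · rfl
  · simp [residual, delta, hk]

lemma IsTarget.residual_seqR {p : Prog S} {k : ℕ} {t : Term S} (h : IsTarget p k t)
    (q : Prog S) : residual k (t.seqR q) = residual k t := by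
  rcases h with ⟨rfl, q, rfl, -⟩ | ⟨hk, rfl⟩
  · rfl
  · simp [residual, delta, hk]

/-- Here the base clause of `IsTarget` is needed: expanding a loop restarts the base of its state,
whereas the behavioral rule restarts `p`. -/
lemma IsTarget.residual_loop {p : Prog S} {k : ℕ} {t : Term S} (h : IsTarget p k t) :
    residual k t.loop = delta k (.seq (residual k t) (.loop p)) := by
  rcases h with ⟨rfl, q, rfl, rfl⟩ | ⟨hk, rfl⟩
  · rfl
  · simp [residual, delta, hk]

/-- `down` changes the code but not whether it is 1, so truncating at `down k` or at `k`, as the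
behavioral rule does, is the same. -/
lemma IsTarget.residual_trap {p : Prog S} {k : ℕ} {t : Term S} (h : IsTarget p k t) :
    residual (down k) t.trap = delta k (.trap (residual k t)) := by
  rcases h with ⟨rfl, q, rfl, rfl⟩ | ⟨hk, rfl⟩
  · rfl
  · simp [residual, delta, hk, down_eq_one]

lemma IsTarget.residual_shift {p : Prog S} {k : ℕ} {t : Term S} (h : IsTarget p k t) :
    residual (up k) t.shift = delta k (.shift (residual k t)) := by
  rcases h with ⟨rfl, q, rfl, rfl⟩ | ⟨hk, rfl⟩
  · rfl
  · simp [residual, delta, hk, up_eq_one]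

lemma IsTarget.residual_signal {p : Prog S} {k : ℕ} {t : Term S} (h : IsTarget p k t) (s : S) :
    residual k (t.signal s) = delta k (.signal s (residual k t)) := by
  rcases h with ⟨rfl, q, rfl, -⟩ | ⟨hk, rfl⟩
  · rfl
  · simp [residual, delta, hk]

lemma IsTarget.residual_par {p q : Prog S} {k l : ℕ} {t u : Term S} (ht : IsTarget p k t)
    (hu : IsTarget q l u) : residual (max k l) ((t.par u).delta (max k l)) =
      delta (max k l) (.par (residual k t) (residual l u)) := by
  by_cases hm : max k l = 1
  -- A maximum of 1 leaves only the codes 0 and 1, not both 0. A branch with code 0 has residual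
  -- `code 0`, which is what the expansion of `parL` or `parR` puts in its place.
  · rcases ht with ⟨rfl, p', rfl, rfl⟩ | ⟨hk, rfl⟩ <;>
      rcases hu with ⟨rfl, q', rfl, rfl⟩ | ⟨hl, rfl⟩ <;>
      first
        | omega
        | simp [*, residual, delta, Term.delta, Term.par, Term.expand, State.expand]
  · simp [residual, delta, hm]

lemma IsTarget.residual_par_prog {p : Prog S} {k : ℕ} {t : Term S} (h : IsTarget p k t)
    (q : Prog S) : residual k (t.par (.prog q)) = delta k (.par (residual k t) (.code 0)) := by
  rcases h with ⟨rfl, p', rfl, -⟩ | ⟨hk, rfl⟩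
  · rfl
  · simp [residual, delta, hk]

lemma IsTarget.residual_prog_par {p : Prog S} {k : ℕ} {t : Term S} (h : IsTarget p k t)
    (q : Prog S) : residual k ((Term.prog q).par t) = delta k (.par (.code 0) (residual k t)) := by
  rcases h with ⟨rfl, p', rfl, -⟩ | ⟨hk, rfl⟩
  · rfl
  · simp [residual, delta, hk]

/-- The state rules for a terminated first component demand that its target be the bare statement;
this makes that premise automatic. -/
lemma IsTarget.eq_prog {p : Prog S} {t : Term S} (h : IsTarget p 0 t) : t = .prog p := by
  simpa [IsTarget] using h

variable [DecidableEq S]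

-- Transitions preserve the shape of targets.

lemma Bisimilar.refl (p : Prog S) : Bisimilar p p :=
  ⟨Eq, by rintro p _ rfl E E' k; exact ⟨fun p' h => ⟨p', h, rfl⟩, fun p' h => ⟨p', h, rfl⟩⟩, rfl⟩

lemma CSSStart.isTarget {p : Prog S} {E : Event S} {E' : Finset S} {k : ℕ} {t : Term S}
    (h : CSSStart p E E' k t) : IsTarget p k t := by
  induction h with
  | exit hk => exact .inr ⟨by omega, rfl⟩
  | par _ _ ihp ihq => exact ihp.par ihq
  | seq_zero _ _ _ ih =>
    rcases ih with ⟨rfl, q', rfl, rfl⟩ | ⟨hk, rfl⟩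
    · exact .inl ⟨rfl, _, rfl, rfl⟩
    · exact .inr ⟨hk, rfl⟩
  | nothing | emit | awimm_now => exact .inr ⟨by simp, rfl⟩
  | pause | awimm_wait => exact .inl ⟨rfl, _, rfl, rfl⟩
  | shift _ ih | trap _ ih =>
    rcases ih with ⟨rfl, q', rfl, rfl⟩ | ⟨hk, rfl⟩
    · exact .inl ⟨rfl, _, rfl, rfl⟩
    · exact .inr ⟨by simpa [up_eq_one, down_eq_one] using hk, rfl⟩
  | _ =>
    rename_i ih
    rcases ih with ⟨rfl, q', rfl, rfl⟩ | ⟨hk, rfl⟩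
    · exact .inl ⟨rfl, _, rfl, rfl⟩
    · exact .inr ⟨hk, rfl⟩

lemma CSSResume.isTarget {p : State S} {E : Event S} {E' : Finset S} {k : ℕ} {t : Term S}
    (h : CSSResume p E E' k t) : IsTarget p.base k t := by
  induction h with
  | par_both _ _ ihp ihq => exact ihp.par ihq
  | seq_zero _ hq _ =>
    rcases hq.isTarget with ⟨rfl, q', rfl, rfl⟩ | ⟨hk, rfl⟩
    · exact .inl ⟨rfl, _, rfl, rfl⟩
    · exact .inr ⟨hk, rfl⟩
  | loop_zero _ _ hq _ =>
    -- The target comes from restarting the loop body, so its shape is given by the start transition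
    -- and not by the terminated one.
    rcases hq.isTarget with ⟨rfl, q', rfl, hb⟩ | ⟨hk, rfl⟩
    · exact .inl ⟨rfl, _, rfl, congrArg Prog.loop hb⟩
    · exact .inr ⟨hk, rfl⟩
  | pause | awimm_now => exact .inr ⟨by simp, rfl⟩
  | suspend_plus | awimm_wait => exact .inl ⟨rfl, _, rfl, rfl⟩
  | shift _ ih | trap _ ih =>
    rcases ih with ⟨rfl, q', rfl, hb⟩ | ⟨hk, rfl⟩
    · exact .inl ⟨rfl, _, rfl, by simp [State.base, hb]⟩
    · exact .inr ⟨by simpa [up_eq_one, down_eq_one] using hk, rfl⟩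
  | _ =>
    rename_i ih
    rcases ih with ⟨rfl, q', rfl, hb⟩ | ⟨hk, rfl⟩
    · exact .inl ⟨rfl, _, rfl, by simp [State.base, hb]⟩
    · exact .inr ⟨hk, rfl⟩

-- From state transitions to behavioral transitions.

theorem CSSStart.cbs {p : Prog S} {E : Event S} {E' : Finset S} {k : ℕ} {t : Term S}
    (h : CSSStart p E E' k t) : CBS p E E' k (residual k t) := by
  induction h with
  | nothing => exact .code
  | pause => exact .code
  | exit hk => rw [residual_eq_zero (by omega)]; exact .code
  | emit hs => exact .emit hs
  | suspend hp ih => rw [hp.isTarget.residual_suspend]; exact .suspend ih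
  | awimm_now hs => exact .awimm_now hs
  | awimm_wait hs => exact .awimm_wait hs
  | ite_then hs hp ih => rw [hp.isTarget.residual_iteL]; exact .ite_then hs ih
  | ite_else hs hp ih => rw [hp.isTarget.residual_iteR]; exact .ite_else hs ih
  | seq_k hk hp ih => rw [hp.isTarget.residual_seqL]; exact .seq_k hk ih
  | seq_zero hp hq ihp ihq => rw [hq.isTarget.residual_seqR]; exact .seq_zero ihp ihq
  | shift hp ih => rw [hp.isTarget.residual_shift]; exact .shift ih
  | loop hk hp ih => rw [hp.isTarget.residual_loop]; exact .loop hk ih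
  | trap hp ih => rw [hp.isTarget.residual_trap]; exact .trap ih
  | par hp hq ihp ihq => rw [hp.isTarget.residual_par hq.isTarget]; exact .par ihp ihq
  | signal_plus hs hp ih => rw [hp.isTarget.residual_signal]; exact .signal_plus hs ih
  | signal_minus hs hp ih => rw [hp.isTarget.residual_signal]; exact .signal_minus hs ih

/-- Each resume rule is replayed on the expansion. Expanded suspensions and loops are sequences, so
their rules become sequence rules; code that is newly entered is handled by `CSSStart.cbs`. -/
theorem CSSResume.cbs {p : State S} {E : Event S} {E' : Finset S} {k : ℕ} {t : Term S}
    (h : CSSResume p E E' k t) : CBS p.expand E E' k (residual k t) := by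
  induction h with
  | pause => exact .code
  | awimm_now hs => exact .awimm_now hs
  | awimm_wait hs => exact .awimm_wait hs
  -- With `s` present the guard `await immediate ¬s` waits, and its derivative is itself, which
  -- reproduces the whole expansion.
  | suspend_plus hs => exact .seq_k one_ne_zero (.awimm_wait hs)
  | suspend_minus hs hp ih =>
    rw [hp.isTarget.residual_suspend]
    simpa [State.expand] using CBS.seq_zero (.awimm_now (b := false) hs) (.suspend ih)
  | ite_then hp ih => rw [hp.isTarget.residual_iteL]; exact ih
  | ite_else hp ih => rw [hp.isTarget.residual_iteR]; exact ih
  | seq_k hk hp ih => rw [hp.isTarget.residual_seqL]; exact .seq_k hk ih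
  | seq_zero hp hq ih => rw [hq.isTarget.residual_seqR]; exact .seq_zero ih hq.cbs
  | seq_right hq ih => rw [hq.isTarget.residual_seqR]; exact ih
  | loop_k hk hp ih => rw [hp.isTarget.residual_loop]; exact .seq_k hk ih
  | loop_zero hk hp hq ih =>
    -- The expansion is the rest of the body followed by the loop; when the rest terminates, the
    -- loop is entered afresh in the same instant.
    rw [hq.isTarget.residual_loop]; exact .seq_zero ih (.loop hk hq.cbs)
  | shift hp ih => rw [hp.isTarget.residual_shift]; exact .shift ih
  | trap hp ih => rw [hp.isTarget.residual_trap]; exact .trap ih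
  | par_both hp hq ihp ihq => rw [hp.isTarget.residual_par hq.isTarget]; exact .par ihp ihq
  | par_left hp ih =>
    rw [hp.isTarget.residual_par_prog]; simpa [State.expand] using CBS.par ih (.code (k := 0))
  | par_right hp ih =>
    rw [hp.isTarget.residual_prog_par]; simpa [State.expand] using CBS.par (.code (k := 0)) ih
  | signal_plus hs hp ih => rw [hp.isTarget.residual_signal]; exact .signal_plus hs ih
  | signal_minus hs hp ih => rw [hp.isTarget.residual_signal]; exact .signal_minus hs ih

-- From behavioral transitions to state transitions.

theorem CBS.exists_start {p p' : Prog S} {E : Event S} {E' : Finset S} {k : ℕ}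
    (h : CBS p E E' k p') : ∃ t : Term S, CSSStart p E E' k t ∧ p' = residual k t := by
  induction h with
  | @code _ k =>
    rcases k with _ | _ | k
    · exact ⟨_, .nothing, rfl⟩
    · exact ⟨_, .pause, rfl⟩
    -- For an exit the state target is `k` itself while the behavioral derivative is 0; `residual`
    -- erases the difference.
    · exact ⟨_, .exit (by omega), by rw [residual_eq_zero (by omega)]⟩
  | emit hs => exact ⟨_, .emit hs, rfl⟩
  | suspend _ ih =>
    obtain ⟨t, ht, rfl⟩ := ih
    exact ⟨_, .suspend ht, (ht.isTarget.residual_suspend _).symm⟩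
  | awimm_now hs => exact ⟨_, .awimm_now hs, rfl⟩
  | awimm_wait hs => exact ⟨_, .awimm_wait hs, rfl⟩
  | ite_then hs _ ih =>
    obtain ⟨t, ht, rfl⟩ := ih
    exact ⟨_, .ite_then hs ht, (ht.isTarget.residual_iteL _ _).symm⟩
  | ite_else hs _ ih =>
    obtain ⟨t, ht, rfl⟩ := ih
    exact ⟨_, .ite_else hs ht, (ht.isTarget.residual_iteR _ _).symm⟩
  | seq_k hk _ ih =>
    obtain ⟨t, ht, rfl⟩ := ih
    exact ⟨_, .seq_k hk ht, (ht.isTarget.residual_seqL _).symm⟩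
  | seq_zero _ _ ihp ihq =>
    obtain ⟨t, ht, rfl⟩ := ihp
    obtain ⟨u, hu, rfl⟩ := ihq
    obtain rfl := ht.isTarget.eq_prog
    exact ⟨_, .seq_zero ht hu, (hu.isTarget.residual_seqR _).symm⟩
  | shift _ ih =>
    obtain ⟨t, ht, rfl⟩ := ih
    exact ⟨_, .shift ht, ht.isTarget.residual_shift.symm⟩
  | loop hk _ ih =>
    obtain ⟨t, ht, rfl⟩ := ih
    exact ⟨_, .loop hk ht, ht.isTarget.residual_loop.symm⟩
  | trap _ ih =>
    obtain ⟨t, ht, rfl⟩ := ih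
    exact ⟨_, .trap ht, ht.isTarget.residual_trap.symm⟩
  | par _ _ ihp ihq =>
    obtain ⟨t, ht, rfl⟩ := ihp
    obtain ⟨u, hu, rfl⟩ := ihq
    exact ⟨_, .par ht hu, (ht.isTarget.residual_par hu.isTarget).symm⟩
  | signal_plus hs _ ih =>
    obtain ⟨t, ht, rfl⟩ := ih
    exact ⟨_, .signal_plus hs ht, (ht.isTarget.residual_signal _).symm⟩
  | signal_minus hs _ ih =>
    obtain ⟨t, ht, rfl⟩ := ih
    exact ⟨_, .signal_minus hs ht, (ht.isTarget.residual_signal _).symm⟩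

/-- The induction is on the state, not on the derivation: several constructors, such as `iteL` and
`seqR`, vanish under expansion, so peeling them off leaves the derivation unchanged. In the other
cases, inverting the behavioral rules on the expansion reveals the resume rule. -/
theorem CBS.exists_resume {p : State S} {p' : Prog S} {E : Event S} {E' : Finset S} {k : ℕ}
    (h : CBS p.expand E E' k p') : ∃ t : Term S, CSSResume p E E' k t ∧ p' = residual k t := by
  induction p generalizing E E' k p' with
  | pause => cases h; exact ⟨_, .pause, rfl⟩
  | awimm b s =>
    cases h with
    | awimm_now hs => exact ⟨_, .awimm_now hs, rfl⟩
    | awimm_wait hs => exact ⟨_, .awimm_wait hs, rfl⟩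
  | suspend s p ih =>
    cases h with
    | seq_k hk hp =>
      cases hp with
      | awimm_now => exact absurd rfl hk
      | awimm_wait hs => exact ⟨_, .suspend_plus hs, rfl⟩
    -- Code 0 means that the guard `await immediate ¬s` fired, so `s` is absent and the body is
    -- resumed.
    | seq_zero hp hq =>
      cases hp with
      | awimm_now hs =>
        cases hq with
        | suspend hq =>
          obtain ⟨t, ht, rfl⟩ := ih hq
          rw [Finset.empty_union]
          exact ⟨_, .suspend_minus hs ht, (ht.isTarget.residual_suspend _).symm⟩
  | iteL s p q ih =>
    obtain ⟨t, ht, rfl⟩ := ih h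
    exact ⟨_, .ite_then ht, (ht.isTarget.residual_iteL _ _).symm⟩
  | iteR s p q ih =>
    obtain ⟨t, ht, rfl⟩ := ih h
    exact ⟨_, .ite_else ht, (ht.isTarget.residual_iteR _ _).symm⟩
  | seqL p q ih =>
    cases h with
    | seq_k hk hp =>
      obtain ⟨t, ht, rfl⟩ := ih hp
      exact ⟨_, .seq_k hk ht, (ht.isTarget.residual_seqL _).symm⟩
    | seq_zero hp hq =>
      obtain ⟨t, ht, rfl⟩ := ih hp
      obtain ⟨u, hu, rfl⟩ := hq.exists_start
      obtain rfl := ht.isTarget.eq_prog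
      exact ⟨_, .seq_zero ht hu, (hu.isTarget.residual_seqR _).symm⟩
  | seqR p q ih =>
    obtain ⟨t, ht, rfl⟩ := ih h
    exact ⟨_, .seq_right ht, (ht.isTarget.residual_seqR _).symm⟩
  | parL p q ih =>
    cases h with
    | par hp hq =>
      -- The finished branch is `code 0`, whose only transition emits nothing with code 0, neutral
      -- for both union and `max`.
      cases hq
      obtain ⟨t, ht, rfl⟩ := ih hp
      rw [Finset.union_empty, Nat.max_zero]
      exact ⟨_, .par_left ht, (ht.isTarget.residual_par_prog _).symm⟩
  | parR p q ih =>
    cases h with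
    | par hp hq =>
      cases hp
      obtain ⟨t, ht, rfl⟩ := ih hq
      rw [Finset.empty_union, Nat.zero_max]
      exact ⟨_, .par_right ht, (ht.isTarget.residual_prog_par _).symm⟩
  | parB p q ihp ihq =>
    cases h with
    | par hp hq =>
      obtain ⟨t, ht, rfl⟩ := ihp hp
      obtain ⟨u, hu, rfl⟩ := ihq hq
      exact ⟨_, .par_both ht hu, (ht.isTarget.residual_par hu.isTarget).symm⟩
  | loop p ih =>
    cases h with
    | seq_k hk hp =>
      obtain ⟨t, ht, rfl⟩ := ih hp
      exact ⟨_, .loop_k hk ht, ht.isTarget.residual_loop.symm⟩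
    | seq_zero hp hq =>
      cases hq with
      -- The restarted body must not terminate instantly; this is the side condition `k ≠ 0` that
      -- `loop_zero` asks for.
      | loop hk hq =>
        obtain ⟨t, ht, rfl⟩ := ih hp
        obtain ⟨u, hu, rfl⟩ := hq.exists_start
        obtain rfl := ht.isTarget.eq_prog
        exact ⟨_, .loop_zero hk ht hu, hu.isTarget.residual_loop.symm⟩
  | trap p ih =>
    cases h with
    | trap hp =>
      obtain ⟨t, ht, rfl⟩ := ih hp
      exact ⟨_, .trap ht, ht.isTarget.residual_trap.symm⟩
  | shift p ih =>
    cases h with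
    | shift hp =>
      obtain ⟨t, ht, rfl⟩ := ih hp
      exact ⟨_, .shift ht, ht.isTarget.residual_shift.symm⟩
  | signal s p ih =>
    cases h with
    | signal_plus hs hp =>
      obtain ⟨t, ht, rfl⟩ := ih hp
      exact ⟨_, .signal_plus hs ht, (ht.isTarget.residual_signal _).symm⟩
    | signal_minus hs hp =>
      obtain ⟨t, ht, rfl⟩ := ih hp
      exact ⟨_, .signal_minus hs ht, (ht.isTarget.residual_signal _).symm⟩

end Esterel

theorem mainTheorem1 {S : Type*} [DecidableEq S] :
    (∀ (p : Esterel.Prog S) (E : Esterel.Event S) (E' : Finset S) (k : ℕ) (p' : Esterel.Prog S),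
      Esterel.CBS p E E' k p' →
        ∃ t : Esterel.Term S, Esterel.CSSStart p E E' k t ∧
          Esterel.Bisimilar p' (Esterel.delta k t.expand)) ∧
    (∀ (p : Esterel.State S) (E : Esterel.Event S) (E' : Finset S) (k : ℕ) (p' : Esterel.Prog S),
      Esterel.CBS p.expand E E' k p' →
        ∃ t : Esterel.Term S, Esterel.CSSResume p E E' k t ∧
          Esterel.Bisimilar p' (Esterel.delta k t.expand)) ∧
    (∀ (p : Esterel.Prog S) (E : Esterel.Event S) (E' : Finset S) (k : ℕ) (t : Esterel.Term S),
      Esterel.CSSStart p E E' k t →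
        ∃ p'' : Esterel.Prog S, Esterel.CBS p E E' k p'' ∧
          Esterel.Bisimilar p'' (Esterel.delta k t.expand)) ∧
    (∀ (p : Esterel.State S) (E : Esterel.Event S) (E' : Finset S) (k : ℕ) (t : Esterel.Term S),
      Esterel.CSSResume p E E' k t →
        ∃ p'' : Esterel.Prog S, Esterel.CBS p.expand E E' k p'' ∧
          Esterel.Bisimilar p'' (Esterel.delta k t.expand)) := by
  -- `residual k t` unfolds to `delta k t.expand`, so each required bisimilarity relates a statement
  -- to itself.
  refine ⟨fun p E E' k p' h => ?_, fun p E E' k p' h => ?_,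
    fun p E E' k t h => ⟨_, h.cbs, .refl _⟩, fun p E E' k t h => ⟨_, h.cbs, .refl _⟩⟩
  · obtain ⟨t, ht, rfl⟩ := h.exists_start
    exact ⟨t, ht, .refl _⟩
  · obtain ⟨t, ht, rfl⟩ := h.exists_resume
    exact ⟨t, ht, .refl _⟩
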